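/- Let $R$ be an integral domain of characteristic zero that is finitely generated as a ring (that is, as a $\mathbb{Z}$-algebra). Then for all but finitely many prime numbers $p$ there exists a maximal ideal $\mathfrak{m}$ of $R$ such that the localization $R_{\mathfrak{m}}$ is regular and unramified of residue characteristic $p$. Here a Noetherian local ring $(S,\mathfrak{n})$ is called regular if its maximal ideal $\mathfrak{n}$ can be generated by $\dim S$ elements (when $S$ is not a field, equivalently: $\mathfrak{n}$ can be generated by a regular sequence); it has residue characteristic $p$ if its residue field $S/\mathfrak{n}$ has characteristic $p$; and a local ring of residue characteristic $p$ is called unramified if $p\notin\mathfrak{n}^2$. -/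

import Mathlib

/-- A local ring `(S, 𝔫)` is unramified of residue characteristic `p` if its residue field `S / 𝔫`
has characteristic `p` and `p ∉ 𝔫 ^ 2`. -/
structure IsUnramifiedOfResidueChar (S : Type*) [CommRing S] [IsLocalRing S] (p : ℕ) : Prop where
  residueChar : CharP (IsLocalRing.ResidueField S) p
  notMem_sq : (p : S) ∉ IsLocalRing.maximalIdeal S ^ 2

/-!
In characteristic zero the fraction field of `R` is formally smooth over `ℤ`
(`Algebra.isSmoothAt_int_bot`), so `R` is smooth over `ℤ` at its generic point. Hence some
localization `S = R[1/f]`, `f ≠ 0`, is étale over a polynomial ring `A = ℤ[x₁, …, xₙ]`. All but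
finitely many primes `p` are non-units of `S` (`finite_setOf_prime_isUnit_natCast`), and for such
a `p` any maximal ideal `Q` of `S` containing `p` works: it contracts to a maximal ideal `m` of `R`,
because `R` is a Jacobson ring, and `R_m = S_Q`.

Let `q = Q ∩ A`. Since `A_q → S_Q` is flat with `q S_Q = Q S_Q`, both properties pass from `A_q` to
`S_Q`: dimension does not drop and the number of generators of the maximal ideal does not grow,
which gives regularity, while faithful flatness gives `(Q S_Q)² ∩ A_q = (q A_q)²`. The ring `A_q` is
regular because `A` is a polynomial ring over `ℤ`. Finally `p ∉ (q A_q)²`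
(`MvPolynomial.natCast_notMem_maximalIdeal_sq`) follows from the Frobenius lift `xᵢ ↦ xᵢ ^ p`: the
`p`-derivation `δ a = (a(x ^ p) - a ^ p) / p` maps `q²` into `q`, but `δ p = 1 - p ^ (p - 1)` lies
outside `q`.
-/

open IsLocalRing

theorem MvPolynomial.expand_sub_pow_mem_span {σ : Type*} (p : ℕ) [Fact p.Prime]
    (a : MvPolynomial σ ℤ) :
    expand p a - a ^ p ∈ Ideal.span {(p : MvPolynomial σ ℤ)} := by
  have h : C ((p : ℕ) : ℤ) ∣ expand p a - a ^ p := by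
    rw [C_dvd_iff_zmod, map_sub, map_pow, map_expand, expand_zmod, sub_self]
  simpa [Ideal.mem_span_singleton] using h

/-- The Frobenius lift `xᵢ ↦ xᵢ ^ p` determines a `p`-derivation `δ`, with
`δ a = (expand p a - a ^ p) / p`; this says `δ (n ^ 2) ⊆ n` for every ideal `n` containing `p`. -/
theorem MvPolynomial.expand_sub_pow_mem_span_mul {σ : Type*} (p : ℕ) [Fact p.Prime]
    {n : Ideal (MvPolynomial σ ℤ)} (hp : (p : MvPolynomial σ ℤ) ∈ n)
    {a : MvPolynomial σ ℤ} (ha : a ∈ n ^ 2) :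
    expand p a - a ^ p ∈ Ideal.span {(p : MvPolynomial σ ℤ)} * n := by
  have hp0 : p ≠ 0 := (Fact.out : p.Prime).ne_zero
  rw [pow_two] at ha
  induction ha using Submodule.mul_induction_on' with
  | mem_mul_mem f hf g hg =>
    obtain ⟨u, hu⟩ := Ideal.mem_span_singleton.mp (expand_sub_pow_mem_span p f)
    obtain ⟨v, hv⟩ := Ideal.mem_span_singleton.mp (expand_sub_pow_mem_span p g)
    rw [Ideal.mem_span_singleton_mul]
    refine ⟨f ^ p * v + g ^ p * u + p * (u * v), ?_, ?_⟩
    · exact n.add_mem (n.add_mem (n.mul_mem_right _ (n.pow_mem_of_mem hf p (by omega)))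
        (n.mul_mem_right _ (n.pow_mem_of_mem hg p (by omega)))) (n.mul_mem_right _ hp)
    · rw [map_mul, eq_add_of_sub_eq hu, eq_add_of_sub_eq hv]
      ring
  | add f hf g hg ihf ihg =>
    have hf' : f ∈ n := Ideal.mul_le_left hf
    obtain ⟨r, hr⟩ := exists_add_pow_prime_eq (Fact.out : p.Prime) f g
    have : expand p (f + g) - (f + g) ^ p =
        (expand p f - f ^ p) + (expand p g - g ^ p) - p * (f * (g * r)) := by
      rw [hr, map_add]; ring
    rw [this]
    exact Ideal.sub_mem _ (Ideal.add_mem _ ihf ihg)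
      (Ideal.mul_mem_mul (Ideal.mem_span_singleton_self _) (n.mul_mem_right _ hf'))

/-- If `s * p ∈ n ^ 2` with `s ∉ n`, then `δ (s * p) ∈ n`, whereas `δ (s * p) ≡ s ^ p` modulo `n`;
here `δ` is the `p`-derivation of `MvPolynomial.expand_sub_pow_mem_span_mul`. -/
theorem MvPolynomial.natCast_notMem_maximalIdeal_sq {σ : Type*} (p : ℕ) [Fact p.Prime]
    (n : Ideal (MvPolynomial σ ℤ)) [n.IsPrime] (hp : (p : MvPolynomial σ ℤ) ∈ n) :
    (p : Localization.AtPrime n) ∉ maximalIdeal (Localization.AtPrime n) ^ 2 := by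
  intro h
  rw [← Localization.AtPrime.map_eq_maximalIdeal, ← Ideal.map_pow,
    ← map_natCast (algebraMap (MvPolynomial σ ℤ) _),
    IsLocalization.algebraMap_mem_map_algebraMap_iff n.primeCompl] at h
  obtain ⟨s, hs, hsp⟩ := h
  have hprime : p.Prime := Fact.out
  have h1 := expand_sub_pow_mem_span_mul p hp hsp
  obtain ⟨u, hu⟩ := Ideal.mem_span_singleton.mp (expand_sub_pow_mem_span p s)
  rw [Ideal.mem_span_singleton_mul] at h1
  obtain ⟨z, hz, hz'⟩ := h1
  have hp0 : (p : MvPolynomial σ ℤ) ≠ 0 := by exact_mod_cast hprime.ne_zero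
  -- `z` is `δ (s * p)` and `u` is `δ s`.
  have h2 : z = s ^ p + p * u - s ^ p * p ^ (p - 1) := by
    apply mul_left_cancel₀ hp0
    rw [hz', map_mul, map_natCast, eq_add_of_sub_eq hu, mul_pow]
    have hpow : (p : MvPolynomial σ ℤ) ^ p = p ^ (p - 1) * p :=
      (pow_sub_one_mul hprime.ne_zero _).symm
    rw [hpow]
    ring
  have h3 : s ^ p = z - p * u + p ^ (p - 1) * s ^ p := by rw [h2]; ring
  refine hs (‹n.IsPrime›.mem_of_pow_mem p ?_)
  rw [h3]
  exact n.add_mem (n.sub_mem hz (n.mul_mem_right _ hp)) (n.mul_mem_right _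
    (n.pow_mem_of_mem hp _ (Nat.sub_pos_of_lt hprime.one_lt)))

/-- Ascent of regularity along a flat local homomorphism with trivial closed fibre. Locality is
implied by the hypothesis on maximal ideals. -/
theorem IsRegularLocalRing.of_flat_of_map_maximalIdeal (A B : Type*) [CommRing A] [CommRing B]
    [IsRegularLocalRing A] [IsLocalRing B] [IsNoetherianRing B] [Algebra A B] [Module.Flat A B]
    (h : (maximalIdeal A).map (algebraMap A B) = maximalIdeal B) : IsRegularLocalRing B := by
  have : (maximalIdeal B).LiesOver (maximalIdeal A) := ⟨by
    refine ((maximalIdeal.isMaximal A).eq_of_le ?_ ?_)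
    · exact Ideal.comap_ne_top _ (maximalIdeal.isMaximal B).ne_top
    · rw [Ideal.under_def, ← h]; exact Ideal.le_comap_map⟩
  apply IsRegularLocalRing.of_spanFinrank_maximalIdeal_le
  -- Going down holds for flat algebras, so the dimension does not drop.
  have hle : (maximalIdeal A).height ≤ (maximalIdeal B).height := by
    rw [Ideal.height_eq_height_add_of_liesOver_of_hasGoingDown (maximalIdeal A) (maximalIdeal B)]
    exact le_self_add
  rw [← maximalIdeal_height_eq_ringKrullDim]
  refine le_trans ?_ (WithBot.coe_le_coe.mpr hle)
  rw [maximalIdeal_height_eq_ringKrullDim, ← IsRegularLocalRing.spanFinrank_maximalIdeal, ← h]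
  have fg := (maximalIdeal A).fg_of_isNoetherianRing
  have fin := Submodule.FG.finite_generators fg
  rw [Nat.cast_le, ← Submodule.FG.generators_ncard fg]
  conv_lhs => rw [← (maximalIdeal A).span_generators]
  change (Ideal.map (algebraMap A B) (Ideal.span _)).spanFinrank ≤ _
  rw [Ideal.map_span]
  exact (Submodule.spanFinrank_span_le_ncard_of_finite (fin.image _)).trans (Set.ncard_image_le fin)

theorem IsLocalRing.algebraMap_notMem_maximalIdeal_sq_of_flat (A B : Type*) [CommRing A]
    [CommRing B] [IsLocalRing A] [IsLocalRing B] [Algebra A B] [Module.Flat A B]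
    [IsLocalHom (algebraMap A B)]
    (h : (maximalIdeal A).map (algebraMap A B) = maximalIdeal B) {x : A}
    (hx : x ∉ maximalIdeal A ^ 2) : algebraMap A B x ∉ maximalIdeal B ^ 2 := by
  have : Module.FaithfullyFlat A B := Module.FaithfullyFlat.of_flat_of_isLocalHom
  rwa [← h, ← Ideal.map_pow, ← Ideal.mem_comap, Ideal.comap_map_eq_self_of_faithfullyFlat]

theorem MvPolynomial.isRegularLocalRing_and_natCast_notMem_sq_of_etale {σ S : Type*}
    [Finite σ] [CommRing S] [Algebra (MvPolynomial σ ℤ) S] [Algebra.Etale (MvPolynomial σ ℤ) S]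
    {p : ℕ} (hp : p.Prime) (Q : Ideal S) [Q.IsPrime] (hpQ : (p : S) ∈ Q) :
    IsRegularLocalRing (Localization.AtPrime Q) ∧
      (p : Localization.AtPrime Q) ∉ maximalIdeal (Localization.AtPrime Q) ^ 2 := by
  have : Fact p.Prime := ⟨hp⟩
  let n := Q.under (MvPolynomial σ ℤ)
  let : Algebra (Localization.AtPrime n) (Localization.AtPrime Q) :=
    Localization.AtPrime.algebraOfLiesOver n Q
  have hmap := ((Algebra.isUnramifiedAt_iff_map_eq (MvPolynomial σ ℤ) n Q).mp inferInstance).2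
  have : Module.Flat (Localization.AtPrime n) (Localization.AtPrime Q) := by
    rw [Module.flat_iff_of_isLocalization _ n.primeCompl]
    exact .trans _ S _
  have : IsNoetherianRing S := Algebra.FiniteType.isNoetherianRing (MvPolynomial σ ℤ) S
  have hmap' : (maximalIdeal (Localization.AtPrime n)).map (algebraMap _ _) =
      maximalIdeal (Localization.AtPrime Q) := by
    rw [← hmap, ← Localization.AtPrime.map_eq_maximalIdeal, Ideal.map_map,
      ← IsScalarTower.algebraMap_eq]
  have hpn : (p : MvPolynomial σ ℤ) ∈ n := by simpa [n] using hpQ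
  refine ⟨.of_flat_of_map_maximalIdeal _ _ hmap', ?_⟩
  simpa using IsLocalRing.algebraMap_notMem_maximalIdeal_sq_of_flat _ _ hmap'
    (MvPolynomial.natCast_notMem_maximalIdeal_sq p n hpn)

/-- `ℤ → ℚ` is a localization, and a finitely generated field extension of the perfect field `ℚ` is
formally smooth. -/
theorem Algebra.FormallySmooth.int_of_charZero (K : Type*) [Field K] [CharZero K] [Algebra ℤ K]
    [Algebra.EssFiniteType ℤ K] : Algebra.FormallySmooth ℤ K := by
  have : Algebra.FormallySmooth ℤ ℚ := .of_isLocalization (nonZeroDivisors ℤ)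
  -- A priori the given `ℤ`-algebra structure, e.g. on a localization, is only propositionally
  -- the standard one.
  obtain rfl : ‹Algebra ℤ K› = Ring.toIntAlgebra K := Subsingleton.elim _ _
  have : Algebra.EssFiniteType ℚ K := .of_comp ℤ _ _
  exact .comp ℤ ℚ _

theorem Algebra.isSmoothAt_int_bot (R : Type*) [CommRing R] [IsDomain R] [CharZero R]
    [Algebra.FiniteType ℤ R] : Algebra.IsSmoothAt ℤ (⊥ : Ideal R) := by
  have : Algebra.EssFiniteType ℤ (FractionRing R) := .comp ℤ R _
  have := Algebra.FormallySmooth.int_of_charZero (FractionRing R)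
  have : IsLocalization.AtPrime (FractionRing R) (⊥ : Ideal R) := by
    rw [IsLocalization.AtPrime, Ideal.primeCompl_bot]; infer_instance
  exact .of_equiv ((IsLocalization.algEquiv (⊥ : Ideal R).primeCompl (FractionRing R)
    (Localization.AtPrime (⊥ : Ideal R))).restrictScalars ℤ)

/-- The nonzero primes of `ℤ` are maximal; the Jacobson radical vanishes because `x * x + 1` is a
unit only for `x = 0`. -/
theorem Int.isJacobsonRing : IsJacobsonRing ℤ := by
  rw [isJacobsonRing_iff_prime_eq]
  intro P hP
  obtain rfl | hP0 := eq_or_ne P ⊥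
  · refine le_antisymm (fun x hx ↦ ?_) Ideal.le_jacobson
    have h := Int.isUnit_iff.mp (Ideal.mem_jacobson_bot.mp hx x)
    have hx0 : x * x = 0 := by rcases h with h | h <;> nlinarith [mul_self_nonneg x]
    simpa using hx0
  · exact Ideal.jacobson_eq_self_of_isMaximal (H := hP.isMaximal hP0)

/-- The map `Spec S → Spec ℤ` is open and hits the generic point, so its image contains all primes
not dividing some fixed nonzero integer. -/
theorem finite_setOf_prime_isUnit_natCast (S : Type*) [CommRing S] [IsDomain S] [CharZero S]
    [Algebra ℤ S] [Algebra.FiniteType ℤ S] : {p : ℕ | p.Prime ∧ IsUnit (p : S)}.Finite := by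
  obtain rfl : ‹Algebra ℤ S› = Ring.toIntAlgebra S := Subsingleton.elim _ _
  have : Algebra.FinitePresentation ℤ S := Algebra.FinitePresentation.of_finiteType.mp ‹_›
  have hopen := PrimeSpectrum.isOpenMap_comap_of_hasGoingDown_of_finitePresentation
    (R := ℤ) (S := S) |>.isOpen_range
  have hbot : (⊥ : PrimeSpectrum ℤ) ∈ Set.range (PrimeSpectrum.comap (algebraMap ℤ S)) :=
    ⟨⊥, PrimeSpectrum.ext (Ideal.comap_bot_of_injective _
      (FaithfulSMul.algebraMap_injective ℤ S))⟩
  obtain ⟨_, ⟨_, ⟨N, rfl⟩, rfl⟩, hN, hsub⟩ :=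
    PrimeSpectrum.isBasis_basic_opens.exists_subset_of_mem_open hbot hopen
  have hN0 : N ≠ 0 := by simpa using hN
  refine (Set.finite_Iic N.natAbs).subset fun p ⟨hp, hu⟩ ↦ ?_
  refine Nat.le_of_dvd (Int.natAbs_pos.mpr hN0) ?_
  by_contra hd
  have hpp : (Ideal.span {(p : ℤ)}).IsPrime := by
    rw [Ideal.span_singleton_prime (by exact_mod_cast hp.ne_zero)]
    exact Nat.prime_iff_prime_int.mp hp
  obtain ⟨q, hq⟩ := hsub (show (⟨_, hpp⟩ : PrimeSpectrum ℤ) ∈ _ by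
    simpa [Ideal.mem_span_singleton, Int.natCast_dvd] using hd)
  have : (p : ℤ) ∈ (PrimeSpectrum.comap (algebraMap ℤ S) q).asIdeal := by
    rw [hq]; exact Ideal.mem_span_singleton_self _
  exact q.2.ne_top (Ideal.eq_top_of_isUnit_mem _ (by simpa using this) hu)

theorem mainTheorem10 (R : Type*) [CommRing R] [IsDomain R] [CharZero R] [Algebra.FiniteType ℤ R] :
    {p : ℕ | p.Prime ∧ ¬ ∃ (m : Ideal R) (_ : m.IsMaximal),
      IsRegularLocalRing (Localization.AtPrime m) ∧
        IsUnramifiedOfResidueChar (Localization.AtPrime m) p}.Finite := by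
  have : Algebra.FinitePresentation ℤ R := Algebra.FinitePresentation.of_finiteType.mp ‹_›
  have := Algebra.isSmoothAt_int_bot R
  obtain ⟨f, hf, n, _, _, _⟩ :=
    Algebra.IsSmoothAt.exists_isStandardEtale_mvPolynomial (R := ℤ) (p := (⊥ : Ideal R))
  have hle : Submonoid.powers f ≤ nonZeroDivisors R :=
    powers_le_nonZeroDivisors_of_noZeroDivisors hf
  have : IsDomain (Localization.Away f) := IsLocalization.isDomain_localization hle
  have : CharZero (Localization.Away f) :=
    charZero_of_injective_algebraMap (IsLocalization.injective (Localization.Away f) hle)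
  have : Algebra.FiniteType R (Localization.Away f) := IsLocalization.finiteType_of_monoid_fg
    (Submonoid.powers f) _
  have : Algebra.FiniteType ℤ (Localization.Away f) := .trans (S := R) ‹_› ‹_›
  have := Int.isJacobsonRing
  have : IsJacobsonRing R := isJacobsonRing_of_finiteType (A := ℤ)
  refine (finite_setOf_prime_isUnit_natCast (Localization.Away f)).subset
    fun p ⟨hp, hne⟩ ↦ ⟨hp, ?_⟩
  by_contra hu
  refine hne ?_
  obtain ⟨Q, hQ, hpQ⟩ := exists_max_ideal_of_mem_nonunits hu
  have hm := ((IsLocalization.isMaximal_iff_isMaximal_disjoint _ f Q).mp hQ).1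
  obtain ⟨hreg, hsq⟩ :=
    MvPolynomial.isRegularLocalRing_and_natCast_notMem_sq_of_etale (σ := Fin n) hp Q hpQ
  -- `S_Q` is also the localization of `R` at the contraction of `Q`.
  have hloc := IsLocalization.isLocalization_isLocalization_atPrime_isLocalization
    (Submonoid.powers f) (Localization.AtPrime Q) Q
  let e : Localization.AtPrime Q ≃+* Localization.AtPrime (Q.under R) :=
    (IsLocalization.algEquiv (Q.under R).primeCompl _ _).toRingEquiv
  refine ⟨Q.under R, hm, .of_ringEquiv e, ?_, ?_⟩
  · have hpm : (p : R) ∈ Q.under R := by simpa using hpQ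
    have hp0 : (p : ResidueField (Localization.AtPrime (Q.under R))) = 0 := by
      rw [← map_natCast (residue _), residue_eq_zero_iff,
        ← map_natCast (algebraMap R (Localization.AtPrime (Q.under R)))]
      exact (IsLocalization.AtPrime.to_map_mem_maximal_iff _ (Q.under R) _).mpr hpm
    exact (CharP.charP_iff_prime_eq_zero hp).mpr hp0
  · rw [← IsLocalRing.map_ringEquiv_maximalIdeal e, ← Ideal.map_pow, ← map_natCast e,
      Ideal.mem_map_of_equiv]
    rintro ⟨x, hx, hxe⟩
    exact hsq (e.injective hxe ▸ hx)
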